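/- The following three series of real numbers converge absolutely and have the indicated sums: $$\sum_{k=0}^\infty\frac{(22k^2+17k-2)\binom{4k}{k}}{(k+1)16^k}=17,$$ $$\sum_{k=0}^\infty\frac{(11k^2+8k+1)\binom{4k}{k}}{(3k+1)(3k+2)16^k}=1,$$ $$\sum_{k=0}^\infty\frac{(22k^2-18k+3)\binom{4k}{k}}{(2k-1)(4k-1)(4k-3)16^k}=-\frac13.$$ -/

import Mathlib

/-! Put `S r = ∑ C(4k + r, k) / 16 ^ k`. Pascal's rule gives a fourth-order linear recurrence in
`r`; the bound `S r = O((4/3) ^ r)` excludes its mode `2 ^ r`, leaving a cubic relation among `S 0,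
…, S 3` (`chooseSeries_cubic_relation`). With `S 3 = 4 * S 0 - 4` this gives `S 2 + 2 * S 1 - 2 * S
0 = 2`, which is twice the second series term by term. The other two series are multiples of the
second plus a telescoping series. -/

theorem HasSum.of_eq_of_eq {f g : ℕ → ℝ} {a b : ℝ} (h : HasSum f a) (hfg : ∀ k, g k = f k)
    (hab : b = a) : HasSum g b := by
  rwa [funext hfg, hab]

/-- One term of the binomial expansion of `(1/3 + 1) ^ n`. The weight `1/3` gives the sharp
exponential rate `256/27` for `C(4k, k)`, and `256/27 < 16`. -/
theorem choose_mul_pow_le (n k : ℕ) : (n.choose k : ℝ) * (1 / 3) ^ k ≤ (4 / 3) ^ n := by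
  rcases le_or_gt k n with hk | hk
  · have h := add_pow (1 / 3 : ℝ) 1 n
    norm_num only [one_pow, mul_one] at h
    rw [h]
    have := Finset.single_le_sum (f := fun m => (1 / 3 : ℝ) ^ m * (n.choose m : ℝ))
      (fun i _ => by positivity) (Finset.mem_range.2 (Nat.lt_succ_of_le hk))
    simpa [mul_comm] using this
  · rw [Nat.choose_eq_zero_of_lt hk]
    simp only [Nat.cast_zero, zero_mul]
    positivity

theorem choose_four_mul_add_div_le (r k : ℕ) :
    ((4 * k + r).choose k : ℝ) / 16 ^ k ≤ (4 / 3) ^ r * (16 / 27) ^ k := by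
  have h := choose_mul_pow_le (4 * k + r) k
  have e : ((4 * k + r).choose k : ℝ) / 16 ^ k
      = ((4 * k + r).choose k : ℝ) * (1 / 3) ^ k * (3 / 16) ^ k := by
    rw [mul_assoc, ← mul_pow, div_eq_mul_inv, ← inv_pow]
    norm_num
  have e' : (4 / 3 : ℝ) ^ r * (16 / 27) ^ k = (4 / 3) ^ (4 * k + r) * (3 / 16) ^ k := by
    rw [pow_add, pow_mul, mul_right_comm, ← mul_pow, mul_comm]
    norm_num
  rw [e, e']
  gcongr

theorem summable_choose_four_mul_add (r : ℕ) :
    Summable fun k : ℕ => ((4 * k + r).choose k : ℝ) / 16 ^ k :=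
  Summable.of_nonneg_of_le (fun k => by positivity) (choose_four_mul_add_div_le r)
    ((summable_geometric_of_lt_one (by norm_num) (by norm_num)).mul_left _)

/-- The series `∑ₖ C(4k + r, k) / 16 ^ k`. -/
noncomputable def chooseSeries (r : ℕ) : ℝ := ∑' k : ℕ, ((4 * k + r).choose k : ℝ) / 16 ^ k

theorem hasSum_chooseSeries (r : ℕ) :
    HasSum (fun k : ℕ => ((4 * k + r).choose k : ℝ) / 16 ^ k) (chooseSeries r) :=
  (summable_choose_four_mul_add r).hasSum

theorem chooseSeries_nonneg (r : ℕ) : 0 ≤ chooseSeries r :=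
  tsum_nonneg fun k => by positivity

theorem chooseSeries_le (r : ℕ) : chooseSeries r ≤ (4 / 3) ^ r * (27 / 11) := by
  have h := (hasSum_geometric_of_lt_one (r := (16 / 27 : ℝ)) (by norm_num) (by norm_num)).mul_left
    ((4 / 3 : ℝ) ^ r)
  have := hasSum_le (choose_four_mul_add_div_le r) (hasSum_chooseSeries r) h
  norm_num at this ⊢
  exact this

theorem hasSum_sub_succ {f : ℕ → ℝ} (hf : Summable f) :
    HasSum (fun k => f (k + 1) - f k) (-f 0) := by
  have h := ((hasSum_nat_add_iff' 1).2 hf.hasSum).sub hf.hasSum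
  simpa using h

theorem chooseSeries_succ (r : ℕ) :
    chooseSeries (r + 1) = chooseSeries r + chooseSeries (r + 4) / 16 := by
  have h := ((hasSum_chooseSeries (r + 1)).sub (hasSum_chooseSeries r))
  -- The terms at `k = 0` are both 1 and cancel; Pascal's rule applies from `k = 1` on.
  have h' := (hasSum_nat_add_iff' 1).2 h
  have h'' : HasSum (fun k : ℕ => ((4 * k + (r + 4)).choose k : ℝ) / 16 ^ k / 16)
      (chooseSeries (r + 1) - chooseSeries r) := by
    refine h'.of_eq_of_eq (fun k => ?_) ?_
    · have : (4 * (k + 1) + (r + 1)).choose (k + 1)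
          = (4 * k + (r + 4)).choose k + (4 * (k + 1) + r).choose (k + 1) := by
        rw [show 4 * (k + 1) + (r + 1) = (4 * k + (r + 4)) + 1 by ring, Nat.choose_succ_succ]
        congr 2
        ring
      rw [this, pow_succ]
      push_cast
      ring
    · simp
  have := h''.unique ((hasSum_chooseSeries (r + 4)).div_const 16)
  linarith

/-- Absorption: `C(4k + 4, k + 1) = 4 * C(4k + 3, k)`. -/
theorem chooseSeries_three : chooseSeries 3 = 4 * chooseSeries 0 - 4 := by
  have h := (hasSum_nat_add_iff' 1).2 (hasSum_chooseSeries 0)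
  have h' : HasSum (fun k : ℕ => ((4 * k + 3).choose k : ℝ) / 16 ^ k / 4)
      (chooseSeries 0 - 1) := by
    refine h.of_eq_of_eq (fun k => ?_) ?_
    · have e := Nat.add_one_mul_choose_eq (4 * k + 3) k
      have e' : (4 * (k + 1) + 0).choose (k + 1) = 4 * (4 * k + 3).choose k := by
        apply Nat.eq_of_mul_eq_mul_right (Nat.succ_pos k)
        rw [show 4 * (k + 1) + 0 = 4 * k + 3 + 1 by ring, Nat.succ_eq_add_one, ← e]
        ring
      rw [e', pow_succ]
      push_cast
      ring
    · simp
  have := h'.unique ((hasSum_chooseSeries 3).div_const 4)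
  linarith

/-- The characteristic polynomial `x⁴ - 16x + 16` of the recurrence for `chooseSeries` factors as
`(x - 2)(x³ + 2x² + 4x - 8)`, and the root `2` does not contribute because of the growth bound
`chooseSeries_le`. -/
theorem chooseSeries_cubic_relation :
    chooseSeries 3 + 2 * chooseSeries 2 + 4 * chooseSeries 1 - 8 * chooseSeries 0 = 0 := by
  set D : ℕ → ℝ := fun r =>
    chooseSeries (r + 3) + 2 * chooseSeries (r + 2) + 4 * chooseSeries (r + 1) - 8 * chooseSeries r
    with hD
  have hrec : ∀ r, D r = 2 ^ r * D 0 := by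
    intro r
    induction r with
    | zero => simp
    | succ r ih =>
      have : D (r + 1) = 2 * D r := by
        have := chooseSeries_succ r
        simp only [hD, show r + 1 + 3 = r + 4 by ring, show r + 1 + 2 = r + 3 by ring,
          show r + 1 + 1 = r + 2 by ring]
        linarith
      rw [this, ih]
      ring
  have hbound : ∀ r, |D 0| ≤ 50 * (2 / 3 : ℝ) ^ r := by
    intro r
    -- Crude constant: the positive terms contribute at most `304/11`, the negative one at most
    -- `216/11`.
    have hDr : |D r| ≤ 50 * (4 / 3 : ℝ) ^ r := by
      have h0 := chooseSeries_le r
      have h1 := chooseSeries_le (r + 1)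
      have h2 := chooseSeries_le (r + 2)
      have h3 := chooseSeries_le (r + 3)
      rw [pow_add] at h1 h2 h3
      have p0 := chooseSeries_nonneg r
      have p1 := chooseSeries_nonneg (r + 1)
      have p2 := chooseSeries_nonneg (r + 2)
      have p3 := chooseSeries_nonneg (r + 3)
      have : (0 : ℝ) < (4 / 3) ^ r := by positivity
      rw [abs_le]
      constructor <;> simp only [hD] <;> linarith
    rw [hrec r, abs_mul, abs_of_pos (by positivity : (0 : ℝ) < 2 ^ r)] at hDr
    have e : (4 / 3 : ℝ) ^ r = 2 ^ r * (2 / 3) ^ r := by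
      rw [← mul_pow]
      norm_num
    rw [e] at hDr
    have hp : (0 : ℝ) < 2 ^ r := by positivity
    exact le_of_mul_le_mul_left (by linarith) hp
  have hlim : Filter.Tendsto (fun r : ℕ => 50 * (2 / 3 : ℝ) ^ r) Filter.atTop (nhds (50 * 0)) :=
    (tendsto_pow_atTop_nhds_zero_of_lt_one (by norm_num) (by norm_num)).const_mul _
  rw [mul_zero] at hlim
  exact abs_nonpos_iff.1 (ge_of_tendsto' hlim hbound)

theorem choose_four_mul_add_one (k : ℕ) :
    ((4 * k + 1).choose k : ℝ) = (4 * k).choose k * (4 * k + 1) / (3 * k + 1) := by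
  have h := Nat.choose_mul_succ_eq (4 * k) k
  rw [show 4 * k + 1 - k = 3 * k + 1 by omega] at h
  rw [eq_div_iff (by positivity)]
  exact_mod_cast h.symm

theorem choose_four_mul_add_two (k : ℕ) :
    ((4 * k + 2).choose k : ℝ) = (4 * k + 1).choose k * (4 * k + 2) / (3 * k + 2) := by
  have h := Nat.choose_mul_succ_eq (4 * k + 1) k
  rw [show 4 * k + 1 + 1 - k = 3 * k + 2 by omega] at h
  rw [eq_div_iff (by positivity)]
  exact_mod_cast h.symm

theorem choose_four_mul_succ (k : ℕ) :
    ((4 * (k + 1)).choose (k + 1) : ℝ) = (4 * k).choose k *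
      (8 * (4 * k + 1) * (2 * k + 1) * (4 * k + 3) / (3 * (k + 1) * (3 * k + 1) * (3 * k + 2))) := by
  have h3 : ((4 * k + 3).choose k : ℝ) = (4 * k + 2).choose k * (4 * k + 3) / (3 * k + 3) := by
    have h := Nat.choose_mul_succ_eq (4 * k + 2) k
    rw [show 4 * k + 2 + 1 - k = 3 * k + 3 by omega] at h
    rw [eq_div_iff (by positivity)]
    exact_mod_cast h.symm
  have h4 : ((4 * (k + 1)).choose (k + 1) : ℝ) * (k + 1) = (4 * k + 4) * (4 * k + 3).choose k := by
    exact_mod_cast (Nat.add_one_mul_choose_eq (4 * k + 3) k).symm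
  rw [h3, choose_four_mul_add_two, choose_four_mul_add_one] at h4
  have hk : (k : ℝ) + 1 ≠ 0 := by positivity
  rw [← eq_div_iff hk] at h4
  rw [h4]
  field_simp
  ring

theorem hasSum_choose_four_mul_div_three_mul :
    HasSum (fun k : ℕ =>
      (11 * (k : ℝ) ^ 2 + 8 * (k : ℝ) + 1) * ((4 * k).choose k : ℝ) /
        ((3 * (k : ℝ) + 1) * (3 * (k : ℝ) + 2) * 16 ^ k)) 1 := by
  have h := (((hasSum_chooseSeries 2).add ((hasSum_chooseSeries 1).mul_left 2)).sub
    ((hasSum_chooseSeries 0).mul_left 2)).div_const 2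
  refine h.of_eq_of_eq (fun k => ?_) ?_
  · rw [choose_four_mul_add_two, choose_four_mul_add_one, add_zero]
    field_simp
    ring
  · linarith [chooseSeries_cubic_relation, chooseSeries_three]

theorem summable_mul_choose_four_mul {p : ℕ → ℝ} {C : ℝ} (hp : ∀ k : ℕ, |p k| ≤ C * (k + 1)) :
    Summable fun k : ℕ => p k * (((4 * k).choose k : ℝ) / 16 ^ k) := by
  have h₁ : Summable fun k : ℕ => (k : ℝ) ^ 1 * (16 / 27 : ℝ) ^ k :=
    summable_pow_mul_geometric_of_norm_lt_one 1 (by norm_num)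
  have h₀ : Summable fun k : ℕ => (16 / 27 : ℝ) ^ k :=
    summable_geometric_of_lt_one (by norm_num) (by norm_num)
  refine Summable.of_norm_bounded ((h₁.add h₀).mul_left C) fun k => ?_
  have hb := choose_four_mul_add_div_le 0 k
  rw [pow_zero, one_mul, add_zero] at hb
  rw [norm_mul, Real.norm_eq_abs, Real.norm_of_nonneg (by positivity)]
  calc |p k| * (((4 * k).choose k : ℝ) / 16 ^ k)
      ≤ C * (k + 1) * (16 / 27) ^ k :=
        mul_le_mul (hp k) hb (by positivity) ((abs_nonneg _).trans (hp k))
    _ = C * ((k : ℝ) ^ 1 * (16 / 27) ^ k + (16 / 27) ^ k) := by ring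

theorem hasSum_choose_four_mul_div_succ :
    HasSum (fun k : ℕ =>
      (22 * (k : ℝ) ^ 2 + 17 * (k : ℝ) - 2) * ((4 * k).choose k : ℝ) /
        (((k : ℝ) + 1) * 16 ^ k)) 17 := by
  -- Telescoping certificate: its differences sum to 12, and `12 + 5 * 1 = 17`.
  have hs := summable_mul_choose_four_mul (p := fun k => -(54 * k + 12)) (C := 54) fun k => by
    rw [abs_neg, abs_of_nonneg (by positivity)]
    linarith
  have h := (hasSum_sub_succ hs).add (hasSum_choose_four_mul_div_three_mul.mul_left 5)
  refine h.of_eq_of_eq (fun k => ?_) ?_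
  · rw [choose_four_mul_succ, pow_succ]
    push_cast
    field_simp
    ring
  · norm_num

theorem hasSum_choose_four_mul_div_odd :
    HasSum (fun k : ℕ =>
      (22 * (k : ℝ) ^ 2 - 18 * (k : ℝ) + 3) * ((4 * k).choose k : ℝ) /
        ((2 * (k : ℝ) - 1) * (4 * (k : ℝ) - 1) * (4 * (k : ℝ) - 3) * 16 ^ k)) (-1 / 3) := by
  -- This certificate vanishes at `k = 0`, so the telescoping part contributes nothing.
  have hs := summable_mul_choose_four_mul
      (p := fun k => -2 * k * (16 * k ^ 2 - 13 * k + 2) / ((2 * k - 1) * (4 * k - 1) * (4 * k - 3)))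
      (C := 10) fun k => by
    rcases Nat.eq_zero_or_pos k with rfl | hk
    · simp
    -- In terms of `m = k - 1` all coefficients are positive.
    · obtain ⟨m, rfl⟩ := Nat.exists_eq_add_of_le hk
      push_cast
      have e : (2 * (1 + m : ℝ) - 1) * (4 * (1 + m) - 1) * (4 * (1 + m) - 3)
          = (2 * m + 1) * (4 * m + 3) * (4 * m + 1) := by ring
      have e' : -2 * (1 + m : ℝ) * (16 * (1 + m) ^ 2 - 13 * (1 + m) + 2)
          = -(2 * (1 + m) * (16 * m ^ 2 + 19 * m + 5)) := by ring
      rw [e, e', abs_div, abs_neg, abs_of_nonneg (by positivity), abs_of_nonneg (by positivity),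
        div_le_iff₀ (by positivity), ← sub_nonneg]
      ring_nf
      positivity
  have h := (hasSum_sub_succ hs).add (hasSum_choose_four_mul_div_three_mul.mul_left (-1 / 3))
  refine h.of_eq_of_eq (fun k => ?_) ?_
  · have odd_ne : ∀ a : ℤ, ∀ b : ℤ, a = 2 * b + 1 → (a : ℝ) ≠ 0 := fun a b hab =>
      Int.cast_ne_zero.2 (by omega)
    have h₁ : 2 * (k : ℝ) - 1 ≠ 0 := by
      exact_mod_cast odd_ne (2 * k - 1) (k - 1) (by ring)
    have h₂ : 4 * (k : ℝ) - 1 ≠ 0 := by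
      exact_mod_cast odd_ne (4 * k - 1) (2 * k - 1) (by ring)
    have h₃ : 4 * (k : ℝ) - 3 ≠ 0 := by
      exact_mod_cast odd_ne (4 * k - 3) (2 * k - 2) (by ring)
    rw [choose_four_mul_succ, pow_succ]
    push_cast
    rw [show 2 * ((k : ℝ) + 1) - 1 = 2 * k + 1 by ring,
      show 4 * ((k : ℝ) + 1) - 1 = 4 * k + 3 by ring,
      show 4 * ((k : ℝ) + 1) - 3 = 4 * k + 1 by ring]
    have hD := mul_ne_zero (mul_ne_zero h₁ h₂) h₃
    -- The denominators at `k + 1` cancel against the ratio of consecutive binomials; those at `k`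
    -- are kept as one atom.
    generalize hd : (2 * (k : ℝ) - 1) * (4 * k - 1) * (4 * k - 3) = d at hD ⊢
    field_simp
    rw [← hd]
    ring
  · norm_num

theorem theorem1p3 :
    HasSum (fun k : ℕ =>
      (22 * (k : ℝ) ^ 2 + 17 * (k : ℝ) - 2) * ((4 * k).choose k : ℝ) /
        (((k : ℝ) + 1) * 16 ^ k)) 17 ∧
    HasSum (fun k : ℕ =>
      (11 * (k : ℝ) ^ 2 + 8 * (k : ℝ) + 1) * ((4 * k).choose k : ℝ) /
        ((3 * (k : ℝ) + 1) * (3 * (k : ℝ) + 2) * 16 ^ k)) 1 ∧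
    HasSum (fun k : ℕ =>
      (22 * (k : ℝ) ^ 2 - 18 * (k : ℝ) + 3) * ((4 * k).choose k : ℝ) /
        ((2 * (k : ℝ) - 1) * (4 * (k : ℝ) - 1) * (4 * (k : ℝ) - 3) * 16 ^ k)) (-1 / 3) := by
  exact ⟨hasSum_choose_four_mul_div_succ, hasSum_choose_four_mul_div_three_mul,
    hasSum_choose_four_mul_div_odd⟩
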